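/- Let $I$ be a finite set of client sites and $J\subseteq I$ the set of potential facility sites. Let demands $d_i\ge 0$ ($i\in I$), unit service costs $c_{ij}\ge 0$ ($i\in I$, $j\in J$) with $c_{jj}=0$ for $j\in J$, capacities $A_j\ge 0$ ($j\in J$), demand-change rates $\theta_i\in\mathbb R$ ($i\in I$), a penalty $C\in\mathbb R$, a weight $\rho\in\mathbb R$, and nonnegative integers $p$ and $k$ be given. Put $$\mathcal X=\Big\{(x_c,x_d)\in\mathbb R_+^{I\times J}\times\{0,1\}^{J}:\ \sum_{j\in J}x_{d,j}=p,\ \ \sum_{j\in J}x_{c,ij}\ge d_i\ \forall i\in I,\ \ \sum_{i\in I}x_{c,ij}\le A_jx_{d,j}\ \forall j\in J\Big\},$$ and, for $x=(x_c,x_d)\in\mathcal X$ and $u\in\mathbb R^I$, $$\mathcal Y(x,u)=\Big\{(y_1,y_2)\in\mathbb R_+^{I\times J}\times\mathbb R_+^{I}:\ \sum_{j\in J}y_{1,ij}+y_{2,i}\ge(1+\theta_iu_i)d_i\ \forall i\in I,\ \ \sum_{i\in I}y_{1,ij}\le A_jx_{d,j},\ \sum_{i\in I}y_{1,ij}\le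 A_j(1-u_j)\ \forall j\in J\Big\}.$$ For a map $x\mapsto\mathcal U(x)\subseteq\mathbb R^I$, consider the two-stage robust optimization problem $$w(\mathcal U)=\min_{x\in\mathcal X}\ (1-\rho)\sum_{i\in I}\sum_{j\in J}c_{ij}x_{c,ij}+\rho\max_{u\in\mathcal U(x)}\ \min_{(y_1,y_2)\in\mathcal Y(x,u)}\Big(\sum_{i\in I}\sum_{j\in J}c_{ij}y_{1,ij}+\sum_{i\in I}C\,y_{2,i}\Big),$$ where the values of the minima and maxima are understood as infima and suprema in $[-\infty,+\infty]$. Let $$\mathcal U^0=\Big\{u\in\{0,1\}^{I}:\sum_{i\in I}u_i\le k\Big\},\qquad \mathcal U^k(x)=\Big\{u\in\mathbb R_+^{I}:\ \sum_{j\in J}u_j\le k,\ \ u_j\le x_{d,j}\ \forall j\in J,\ \ u_i=0\ \forall i\notin J\Big\}.$$ If $C\ge c_{ij}$ for all $i\in I$, $j\in J$, and $\theta_i\le 0$ for all $i\in I$, then the problem with the decision-independent uncertainty set $\mathcal U^0$ (for every $x$) and the problem with the decision-dependent uncertainty set $\mathcal U^k(x)$ are equivalent: they have the same optimal value, and every optimal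 first-stage solution $x\in\mathcal X$ of either problem is an optimal first-stage solution of the other. -/

import Mathlib

/-- A minimization problem over first-stage decisions, with values in the extended reals. -/
structure MinProblem (α : Type*) where
  /-- the set of admissible first-stage decisions -/
  feasible : Set α
  /-- the objective, `⊤` when the decision makes the second stage infeasible -/
  objective : α → EReal

namespace MinProblem

variable {α : Type*}

/-- The optimal value; it is `⊤` for an infeasible problem. -/
noncomputable def optimalValue (P : MinProblem α) : EReal :=
  ⨅ x ∈ P.feasible, P.objective x

/-- `x` is an optimal solution: it is admissible, its objective value is a finite number, and no
admissible decision does better. -/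
def IsOptimalSolution (P : MinProblem α) (x : α) : Prop :=
  x ∈ P.feasible ∧ P.objective x ≠ ⊤ ∧ P.objective x ≠ ⊥ ∧
    ∀ x' ∈ P.feasible, P.objective x ≤ P.objective x'

/-- Two formulations are equivalent when they have the same optimal value and every optimal
first-stage solution of either one is optimal for the other. -/
def Equivalent (P Q : MinProblem α) : Prop :=
  P.optimalValue = Q.optimalValue ∧
    ∀ x : α, P.IsOptimalSolution x ↔ Q.IsOptimalSolution x

end MinProblem

/-- Data of the reliable `p`-median problem, on a finite set `I` of client sites. -/
structure ReliablePMedian (I : Type*) [Fintype I] where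
  /-- potential facility sites -/
  J : Finset I
  /-- nominal demands -/
  d : I → ℝ
  /-- unit service costs -/
  c : I → J → ℝ
  /-- facility capacities -/
  A : J → ℝ
  /-- relative change of the demand of a disrupted site -/
  θ : I → ℝ
  /-- unit penalty for unmet demand -/
  C : ℝ
  /-- weight of the worst disruptive scenario -/
  ρ : ℝ
  /-- number of facilities to build -/
  p : ℕ
  /-- largest number of disruptions -/
  k : ℕ
  d_nonneg : ∀ i, 0 ≤ d i
  c_nonneg : ∀ i j, 0 ≤ c i j
  c_self : ∀ j : J, c j j = 0
  A_nonneg : ∀ j, 0 ≤ A j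

namespace ReliablePMedian

variable {I : Type*} [Fintype I] (R : ReliablePMedian I)

/-- First-stage variables: allocations `xc` and construction decisions `xd`. -/
structure FirstStage where
  /-- allocation of the demand of `i` to facility `j` -/
  xc : I → R.J → ℝ
  /-- whether a facility is built at `j` -/
  xd : R.J → ℝ

/-- Recourse variables: re-allocations `y₁` and unmet demands `y₂`. -/
structure Recourse where
  /-- re-allocation of the demand of `i` to facility `j` -/
  y₁ : I → R.J → ℝ
  /-- unmet demand of `i` -/
  y₂ : I → ℝ

/-- The set `𝒳` of first-stage decisions. -/
def X : Set R.FirstStage :=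
  {x | (∀ i j, 0 ≤ x.xc i j) ∧ (∀ j, x.xd j = 0 ∨ x.xd j = 1) ∧
    (∑ j, x.xd j = (R.p : ℝ)) ∧
    (∀ i, R.d i ≤ ∑ j, x.xc i j) ∧
    (∀ j, ∑ i, x.xc i j ≤ R.A j * x.xd j)}

/-- The decision-independent uncertainty set `𝒰⁰`: at most `k` sites are disrupted. -/
def U0 : Set (I → ℝ) :=
  {u | (∀ i, u i = 0 ∨ u i = 1) ∧ ∑ i, u i ≤ (R.k : ℝ)}

/-- The decision-dependent uncertainty polytope `𝒰ᵏ(x)`. -/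
def Uk (x : R.FirstStage) : Set (I → ℝ) :=
  {u | (∀ i, 0 ≤ u i) ∧ (∑ j : R.J, u j ≤ (R.k : ℝ)) ∧
    (∀ j : R.J, u j ≤ x.xd j) ∧ (∀ i, i ∉ R.J → u i = 0)}

/-- The recourse feasible set `𝒴(x, u)`. -/
def Y (x : R.FirstStage) (u : I → ℝ) : Set R.Recourse :=
  {y | (∀ i j, 0 ≤ y.y₁ i j) ∧ (∀ i, 0 ≤ y.y₂ i) ∧
    (∀ i, (1 + R.θ i * u i) * R.d i ≤ ∑ j, y.y₁ i j + y.y₂ i) ∧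
    (∀ j, ∑ i, y.y₁ i j ≤ R.A j * x.xd j) ∧
    (∀ j : R.J, ∑ i, y.y₁ i j ≤ R.A j * (1 - u j))}

/-- Operational cost of the normal, disruption-free scenario. -/
def normalCost (x : R.FirstStage) : ℝ :=
  ∑ i, ∑ j, R.c i j * x.xc i j

/-- Cost of a recourse decision. -/
def recourseCost (y : R.Recourse) : ℝ :=
  ∑ i, ∑ j, R.c i j * y.y₁ i j + ∑ i, R.C * y.y₂ i

/-- Optimal value of the recourse problem for decision `x` and scenario `u`. -/
noncomputable def recourseValue (x : R.FirstStage) (u : I → ℝ) : EReal :=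
  ⨅ y ∈ R.Y x u, (R.recourseCost y : EReal)

/-- Worst-case recourse value of `x` over the uncertainty set `U x`. -/
noncomputable def worstCase (U : R.FirstStage → Set (I → ℝ)) (x : R.FirstStage) : EReal :=
  ⨆ u ∈ U x, R.recourseValue x u

/-- The two-stage robust optimization formulation with uncertainty set `x ↦ U x`. -/
noncomputable def twoStageRO (U : R.FirstStage → Set (I → ℝ)) : MinProblem R.FirstStage where
  feasible := R.X
  objective x := (((1 - R.ρ) * R.normalCost x : ℝ) : EReal) + (R.ρ : EReal) * R.worstCase U x

end ReliablePMedian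

/-! For each fixed admissible `x` the two worst cases coincide, so the objectives agree on `X`,
whatever the sign of `ρ`. `worstCase_Uk_le`: `Uk x` lies in the box-budget polytope, whose extreme
points are 0-1 vectors because `k` is an integer; hence it lies in the convex hull of `U0`. The
recourse value is quasiconvex in the scenario, so its supremum over `U0` bounds it on that hull.
`worstCase_U0_le`: disrupting a site without a facility never hurts. It removes no capacity and, as
`θ ≤ 0`, cannot raise demand, so such disruptions can be dropped, which leaves a scenario in `Uk x`.
-/

/-- The box-constrained vectors with coordinate sum at most `k`. -/
def boxBudgetPolytope (ι : Type*) [Fintype ι] (k : ℕ) : Set (ι → ℝ) :=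
  {u | (∀ i, 0 ≤ u i ∧ u i ≤ 1) ∧ ∑ i, u i ≤ (k : ℝ)}

/-! ### Integrality of the box-budget polytope -/

section BoxBudget

variable {ι : Type*} [Fintype ι] {k : ℕ}

theorem convex_boxBudgetPolytope : Convex ℝ (boxBudgetPolytope ι k) := by
  rintro u ⟨hu, hu'⟩ v ⟨hv, hv'⟩ a b ha hb hab
  refine ⟨fun i => ?_, ?_⟩
  · have h1 := mul_nonneg ha (hu i).1
    have h2 := mul_nonneg hb (hv i).1
    have h3 := mul_le_mul_of_nonneg_left (hu i).2 ha
    have h4 := mul_le_mul_of_nonneg_left (hv i).2 hb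
    simp only [Pi.add_apply, Pi.smul_apply, smul_eq_mul]
    constructor <;> linarith
  · simp only [Pi.add_apply, Pi.smul_apply, smul_eq_mul, Finset.sum_add_distrib,
      ← Finset.mul_sum]
    calc a * ∑ i, u i + b * ∑ i, v i ≤ a * k + b * k := by gcongr
      _ = k := by rw [← add_mul, hab, one_mul]

theorem isCompact_boxBudgetPolytope : IsCompact (boxBudgetPolytope ι k) := by
  have h : boxBudgetPolytope ι k = Set.Icc 0 1 ∩ {u | ∑ i, u i ≤ (k : ℝ)} := by
    ext u
    simp [boxBudgetPolytope, Pi.le_def, forall_and]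
  rw [h]
  exact isCompact_Icc.inter_right (isClosed_le (by fun_prop) continuous_const)

/-- A point that stays in a set when moved both ways along `w ≠ 0` is not an extreme point. -/
theorem notMem_extremePoints_of_add_sub {E : Type*} [AddCommGroup E] [Module ℝ E] {s : Set E}
    {x w : E} (hw : w ≠ 0) (h₁ : x + w ∈ s) (h₂ : x - w ∈ s) : x ∉ s.extremePoints ℝ := by
  intro hx
  have hseg : x ∈ openSegment ℝ (x + w) (x - w) :=
    ⟨1 / 2, 1 / 2, by norm_num, by norm_num, by norm_num, by module⟩
  have := hx.2 h₁ h₂ hseg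
  exact hw (by simpa using this)

/-- A fractional coordinate can be moved both ways: alone if the budget is slack, against a second
fractional coordinate if it is tight. -/
theorem extremePoints_boxBudgetPolytope_integral {u : ι → ℝ}
    (hu : u ∈ (boxBudgetPolytope ι k).extremePoints ℝ) (i : ι) : u i = 0 ∨ u i = 1 := by
  classical
  by_contra! hi
  obtain ⟨hbox, hsum⟩ := hu.1
  have hpos : ∀ j, u j ≠ 0 → 0 < u j := fun j h => lt_of_le_of_ne (hbox j).1 h.symm
  have hlt : ∀ j, u j ≠ 1 → u j < 1 := fun j h => lt_of_le_of_ne (hbox j).2 h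
  have hi0 := hpos i hi.1
  have hi1 := hlt i hi.2
  rcases hsum.lt_or_eq with hs | hs
  · obtain ⟨ε, hε, hε'⟩ : ∃ ε : ℝ, 0 < ε ∧ ε < min (min (u i) (1 - u i)) (k - ∑ j, u j) :=
      exists_between (by simp [hi0, hi1, hs])
    simp only [lt_min_iff] at hε'
    have hmem : ∀ δ : ℝ, |δ| ≤ ε → u + Pi.single i δ ∈ boxBudgetPolytope ι k := by
      intro δ hδ
      obtain ⟨hδ₁, hδ₂⟩ := abs_le.mp hδ
      refine ⟨fun j => ?_, ?_⟩
      · rcases eq_or_ne j i with rfl | hj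
        · simp only [Pi.add_apply, Pi.single_eq_same]
          constructor <;> linarith
        · simpa [hj] using hbox j
      · simp only [Pi.add_apply, Finset.sum_add_distrib, Finset.sum_pi_single', Finset.mem_univ,
          if_true]
        linarith
    refine notMem_extremePoints_of_add_sub (w := Pi.single i ε) (by simp [hε.ne'])
      (hmem ε (abs_of_pos hε).le) ?_ hu
    rw [sub_eq_add_neg, ← Pi.single_neg]
    exact hmem (-ε) (by rw [abs_neg, abs_of_pos hε])
  · obtain ⟨j, hji, hj0, hj1⟩ : ∃ j, j ≠ i ∧ u j ≠ 0 ∧ u j ≠ 1 := by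
      -- Were all other coordinates 0 or 1, their sum would be an integer at distance `u i` from
      -- `k`, with `0 < u i < 1`.
      by_contra! hall
      have hcard : ∑ j ∈ Finset.univ.erase i, u j
          = (((Finset.univ.erase i).filter fun j => u j ≠ 0).card : ℝ) := by
        rw [Finset.card_filter, Nat.cast_sum]
        refine Finset.sum_congr rfl fun j hj => ?_
        by_cases h0 : u j = 0
        · simp [h0]
        · simp [hall j (Finset.ne_of_mem_erase hj) h0]
      have hadd := Finset.add_sum_erase Finset.univ u (Finset.mem_univ i)
      rw [hcard, hs] at hadd
      have h1 : ((Finset.univ.erase i).filter fun j => u j ≠ 0).card < k := by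
        exact_mod_cast (by linarith :
          (((Finset.univ.erase i).filter fun j => u j ≠ 0).card : ℝ) < k)
      have h2 : k < ((Finset.univ.erase i).filter fun j => u j ≠ 0).card + 1 := by
        exact_mod_cast (by linarith :
          (k : ℝ) < (((Finset.univ.erase i).filter fun j => u j ≠ 0).card : ℝ) + 1)
      omega
    have hj0 := hpos j hj0
    have hj1 := hlt j hj1
    obtain ⟨ε, hε, hε'⟩ : ∃ ε : ℝ, 0 < ε ∧
        ε < min (min (u i) (1 - u i)) (min (u j) (1 - u j)) :=
      exists_between (by simp [hi0, hi1, hj0, hj1])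
    simp only [lt_min_iff] at hε'
    have hmem : ∀ δ : ℝ, |δ| ≤ ε →
        u + (Pi.single i δ - Pi.single j δ) ∈ boxBudgetPolytope ι k := by
      intro δ hδ
      obtain ⟨hδ₁, hδ₂⟩ := abs_le.mp hδ
      refine ⟨fun l => ?_, ?_⟩
      · rcases eq_or_ne l i with rfl | hli
        · simp only [Pi.add_apply, Pi.sub_apply, Pi.single_eq_same,
            Pi.single_eq_of_ne hji.symm]
          constructor <;> linarith
        · rcases eq_or_ne l j with rfl | hlj
          · simp only [Pi.add_apply, Pi.sub_apply, Pi.single_eq_same, Pi.single_eq_of_ne hji]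
            constructor <;> linarith
          · simpa [hli, hlj] using hbox l
      · simp only [Pi.add_apply, Pi.sub_apply, Finset.sum_add_distrib, Finset.sum_sub_distrib,
          Finset.sum_pi_single', Finset.mem_univ, if_true]
        linarith
    refine notMem_extremePoints_of_add_sub (w := Pi.single i ε - Pi.single j ε) ?_
      (hmem ε (abs_of_pos hε).le) ?_ hu
    · intro h
      have := congrFun h i
      simp [hji.symm, hε.ne'] at this
    · have := hmem (-ε) (by rw [abs_neg, abs_of_pos hε])
      convert this using 1
      rw [Pi.single_neg, Pi.single_neg]
      abel

/-- Krein–Milman; the closure is harmless since the convex hull of finitely many points is closed.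
-/
theorem boxBudgetPolytope_subset_convexHull :
    boxBudgetPolytope ι k ⊆
      convexHull ℝ {u : ι → ℝ | (∀ i, u i = 0 ∨ u i = 1) ∧ ∑ i, u i ≤ (k : ℝ)} := by
  have hfin : {u : ι → ℝ | (∀ i, u i = 0 ∨ u i = 1) ∧ ∑ i, u i ≤ (k : ℝ)}.Finite := by
    refine (Set.Finite.pi' (fun _ : ι => Set.toFinite ({0, 1} : Set ℝ))).subset ?_
    intro u hu i
    simpa using hu.1 i
  rw [← closure_convexHull_extremePoints isCompact_boxBudgetPolytope
    convex_boxBudgetPolytope]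
  refine closure_minimal (convexHull_mono fun u hu => ?_) (hfin.isClosed_convexHull ℝ)
  exact ⟨extremePoints_boxBudgetPolytope_integral hu, hu.1.2⟩

end BoxBudget

namespace ReliablePMedian

variable {I : Type*} [Fintype I] (R : ReliablePMedian I)

/-! ### Quasiconvexity of the recourse value -/

/-- The convex combination of two recourse decisions. -/
def Recourse.combo {R : ReliablePMedian I} (a b : ℝ) (y z : R.Recourse) : R.Recourse where
  y₁ i j := a * y.y₁ i j + b * z.y₁ i j
  y₂ i := a * y.y₂ i + b * z.y₂ i

theorem recourseCost_combo (a b : ℝ) (y z : R.Recourse) :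
    R.recourseCost (Recourse.combo a b y z) = a * R.recourseCost y + b * R.recourseCost z := by
  simp only [recourseCost, Recourse.combo, mul_add, Finset.mul_sum, Finset.sum_add_distrib,
    mul_left_comm]
  ring

/-- For fixed `x`, the recourse constraints are jointly affine in `(y, u)`. -/
theorem combo_mem_Y {x : R.FirstStage} {u v : I → ℝ} {y z : R.Recourse} (hy : y ∈ R.Y x u)
    (hz : z ∈ R.Y x v) {a b : ℝ} (ha : 0 ≤ a) (hb : 0 ≤ b) (hab : a + b = 1) :
    Recourse.combo a b y z ∈ R.Y x (a • u + b • v) := by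
  obtain ⟨hy1, hy2, hy3, hy4, hy5⟩ := hy
  obtain ⟨hz1, hz2, hz3, hz4, hz5⟩ := hz
  obtain rfl : b = 1 - a := by linarith
  refine ⟨fun i j => ?_, fun i => ?_, fun i => ?_, fun j => ?_, fun j => ?_⟩ <;>
    simp only [Recourse.combo, Pi.add_apply, Pi.smul_apply, smul_eq_mul, Finset.sum_add_distrib,
      ← Finset.mul_sum]
  · exact add_nonneg (mul_nonneg ha (hy1 i j)) (mul_nonneg hb (hz1 i j))
  · exact add_nonneg (mul_nonneg ha (hy2 i)) (mul_nonneg hb (hz2 i))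
  · linarith [mul_le_mul_of_nonneg_left (hy3 i) ha, mul_le_mul_of_nonneg_left (hz3 i) hb]
  · linarith [mul_le_mul_of_nonneg_left (hy4 j) ha, mul_le_mul_of_nonneg_left (hz4 j) hb]
  · linarith [mul_le_mul_of_nonneg_left (hy5 j) ha, mul_le_mul_of_nonneg_left (hz5 j) hb]

/-- Strict sublevel sets supply actual recourse decisions to combine, so neither attained minima nor
finite values are needed. -/
theorem convex_setOf_recourseCost_lt (x : R.FirstStage) (M : EReal) :
    Convex ℝ {u | ∃ y ∈ R.Y x u, (R.recourseCost y : EReal) < M} := by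
  rintro u ⟨y, hy, hyM⟩ v ⟨z, hz, hzM⟩ a b ha hb hab
  refine ⟨_, R.combo_mem_Y hy hz ha hb hab, ?_⟩
  refine lt_of_le_of_lt ?_ (max_lt hyM hzM)
  rw [recourseCost_combo, ← EReal.coe_strictMono.monotone.map_max, EReal.coe_le_coe_iff]
  calc a * R.recourseCost y + b * R.recourseCost z
      ≤ a * max (R.recourseCost y) (R.recourseCost z)
        + b * max (R.recourseCost y) (R.recourseCost z) := by
        gcongr
        exacts [le_max_left _ _, le_max_right _ _]
    _ = max (R.recourseCost y) (R.recourseCost z) := by rw [← add_mul, hab, one_mul]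

/-- The worst case over a set of scenarios bounds the recourse value on its convex hull. -/
theorem recourseValue_le_of_mem_convexHull {x : R.FirstStage} {S : Set (I → ℝ)} {u : I → ℝ}
    (hu : u ∈ convexHull ℝ S) : R.recourseValue x u ≤ ⨆ v ∈ S, R.recourseValue x v := by
  refine le_of_forall_gt_imp_ge_of_dense fun M hM => ?_
  have hS : S ⊆ {u | ∃ y ∈ R.Y x u, (R.recourseCost y : EReal) < M} := by
    intro v hv
    have hvM : R.recourseValue x v < M :=
      (le_iSup₂ (f := fun v _ => R.recourseValue x v) v hv).trans_lt hM
    simpa [recourseValue, iInf_lt_iff] using hvM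
  obtain ⟨y, hy, hyM⟩ := convexHull_min hS (R.convex_setOf_recourseCost_lt x M) hu
  exact (iInf₂_le y hy).trans hyM.le

/-! ### Comparison of the two worst cases -/

theorem Uk_subset_boxBudgetPolytope {x : R.FirstStage} (hx : x ∈ R.X) :
    R.Uk x ⊆ boxBudgetPolytope I R.k := by
  rintro u ⟨hu0, hsum, hle, hout⟩
  refine ⟨fun i => ⟨hu0 i, ?_⟩, ?_⟩
  · by_cases hi : i ∈ R.J
    · refine (hle ⟨i, hi⟩).trans ?_
      rcases hx.2.1 ⟨i, hi⟩ with h | h <;> simp [h]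
    · simp [hout i hi]
  · rwa [← Finset.sum_subset (Finset.subset_univ R.J) fun i _ hi => hout i hi,
      ← Finset.sum_coe_sort]

theorem worstCase_Uk_le {x : R.FirstStage} (hx : x ∈ R.X) :
    R.worstCase (fun x => R.Uk x) x ≤ R.worstCase (fun _ => R.U0) x :=
  iSup₂_le fun _ hu => R.recourseValue_le_of_mem_convexHull
    (boxBudgetPolytope_subset_convexHull (R.Uk_subset_boxBudgetPolytope hx hu))

open Classical in
/-- The scenario `u` restricted to the sites where a facility is built. -/
noncomputable def restrictToBuilt (x : R.FirstStage) (u : I → ℝ) (i : I) : ℝ :=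
  if ∃ h : i ∈ R.J, x.xd ⟨i, h⟩ = 1 then u i else 0

theorem restrictToBuilt_le {x : R.FirstStage} {u : I → ℝ} (hu : ∀ i, 0 ≤ u i) (i : I) :
    R.restrictToBuilt x u i ≤ u i := by
  unfold restrictToBuilt
  split_ifs
  exacts [le_rfl, hu i]

theorem U0_nonneg {u : I → ℝ} (hu : u ∈ R.U0) (i : I) : 0 ≤ u i := by
  rcases hu.1 i with h | h <;> simp [h]

theorem U0_le_one {u : I → ℝ} (hu : u ∈ R.U0) (i : I) : u i ≤ 1 := by
  rcases hu.1 i with h | h <;> simp [h]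

theorem restrictToBuilt_mem_Uk {x : R.FirstStage} (hx : x ∈ R.X) {u : I → ℝ} (hu : u ∈ R.U0) :
    R.restrictToBuilt x u ∈ R.Uk x := by
  have h0 : ∀ i, 0 ≤ R.restrictToBuilt x u i := fun i => by
    unfold restrictToBuilt
    split_ifs
    exacts [R.U0_nonneg hu i, le_rfl]
  refine ⟨h0, ?_, fun j => ?_, fun i hi => if_neg fun h => hi h.1⟩
  · rw [Finset.sum_coe_sort R.J (R.restrictToBuilt x u)]
    calc ∑ i ∈ R.J, R.restrictToBuilt x u i ≤ ∑ i, R.restrictToBuilt x u i :=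
          Finset.sum_le_univ_sum_of_nonneg h0
      _ ≤ ∑ i, u i := Finset.sum_le_sum fun i _ => R.restrictToBuilt_le (R.U0_nonneg hu) i
      _ ≤ R.k := hu.2
  · rcases hx.2.1 j with h | h
    · simp [restrictToBuilt, h]
    · rw [h]
      exact (R.restrictToBuilt_le (R.U0_nonneg hu) j).trans (R.U0_le_one hu j)

/-- At an unbuilt site `A j * x.xd j = 0` already forces the flow bound that a disruption would
impose; elsewhere `u` is unchanged. Lowering `u` only tightens the demand constraints, as `θ ≤ 0`.
-/
theorem Y_restrictToBuilt_subset (hθ : ∀ i, R.θ i ≤ 0) {x : R.FirstStage} (hx : x ∈ R.X)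
    {u : I → ℝ} (hu : u ∈ R.U0) : R.Y x (R.restrictToBuilt x u) ⊆ R.Y x u := by
  rintro y ⟨h1, h2, h3, h4, h5⟩
  refine ⟨h1, h2, fun i => le_trans ?_ (h3 i), h4, fun j => ?_⟩
  · have := mul_le_mul_of_nonpos_left (R.restrictToBuilt_le (x := x) (R.U0_nonneg hu) i) (hθ i)
    exact mul_le_mul_of_nonneg_right (by linarith) (R.d_nonneg i)
  · rcases hx.2.1 j with h | h
    · have h4' := h4 j
      rw [h, mul_zero] at h4'
      exact h4'.trans (mul_nonneg (R.A_nonneg j) (sub_nonneg.mpr (R.U0_le_one hu j)))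
    · simpa [restrictToBuilt, h] using h5 j

theorem worstCase_U0_le (hθ : ∀ i, R.θ i ≤ 0) {x : R.FirstStage} (hx : x ∈ R.X) :
    R.worstCase (fun _ => R.U0) x ≤ R.worstCase (fun x => R.Uk x) x :=
  iSup₂_le fun _ hu =>
    (biInf_mono (R.Y_restrictToBuilt_subset hθ hx hu)).trans
      (le_iSup₂ (f := fun v (_ : v ∈ R.Uk x) => R.recourseValue x v) _
        (R.restrictToBuilt_mem_Uk hx hu))

end ReliablePMedian

/-- Problems with the same admissible decisions, and the same objective there, are equivalent. -/
theorem MinProblem.equivalent_of_eqOn {α : Type*} {P Q : MinProblem α}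
    (hf : P.feasible = Q.feasible) (ho : Set.EqOn P.objective Q.objective P.feasible) :
    P.Equivalent Q := by
  obtain ⟨F, f⟩ := P
  obtain ⟨G, g⟩ := Q
  obtain rfl : F = G := hf
  change ∀ x ∈ F, f x = g x at ho
  refine ⟨biInf_congr ho, fun x => and_congr_right fun hx => ?_⟩
  change x ∈ F at hx
  change (f x ≠ ⊤ ∧ f x ≠ ⊥ ∧ ∀ x' ∈ F, f x ≤ f x') ↔ (g x ≠ ⊤ ∧ g x ≠ ⊥ ∧ ∀ x' ∈ F, g x ≤ g x')
  rw [ho x hx]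
  exact and_congr_right fun _ => and_congr_right fun _ =>
    forall₂_congr fun x' hx' => by rw [ho x' hx']

theorem mainTheorem10 {I : Type*} [Fintype I] (R : ReliablePMedian I)
    (hC : ∀ (i : I) (j : R.J), R.c i j ≤ R.C)
    (hθ : ∀ i : I, R.θ i ≤ 0) :
    (R.twoStageRO (fun _ => R.U0)).Equivalent (R.twoStageRO (fun x => R.Uk x)) := by
  refine MinProblem.equivalent_of_eqOn rfl fun x hx => ?_
  simp only [ReliablePMedian.twoStageRO]
  rw [le_antisymm (R.worstCase_U0_le hθ hx) (R.worstCase_Uk_le hx)]
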